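/- Work over $\mathbb C$. Let $Y=\mathbb P^{n_1}\times\dots\times\mathbb P^{n_k}$ and let $\nu:Y\to\mathbb P^M=\mathbb P(\mathbb C^{n_1+1}\otimes\dots\otimes\mathbb C^{n_k+1})$ be the Segre embedding. For $u\subseteq\{1,\dots,k\}$ let $\mathcal O(u)$ be the line bundle on $Y$ which is the tensor product of the pullbacks of $\mathcal O_{\mathbb P^{n_i}}(1)$ for $i\in u$, and for a closed subscheme $Z\subseteq Y$ with ideal sheaf $\mathcal I_Z$ put $\mathcal I_Z(u)=\mathcal I_Z\otimes\mathcal O(u)$ and $h^p(\mathcal I_Z(u))=\dim_{\mathbb C}H^p(Y,\mathcal I_Z(u))$. The linear span $\langle\nu(Z)\rangle$ is the intersection of all hyperplanes of $\mathbb P^M$ that contain $\nu(Z)$ as a scheme. **Theorem 3.1.** Let $E\sqcup F=\{1,\dots,k\}$ be a partition into two non-empty sets, put $M_F=\prod_{i\in F}(n_i+1)$, and let $c$ be an integer with $0<c<M_F$. Let $A\subset Y$ be a zero-dimensional closed subscheme with $$h^1(\mathcal I_A(E))=0\quad\text{and}\quad h^0(\mathcal I_A(F))<M_F-c .$$ Let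 $T\in\langle\nu(A)\rangle$ be a point such that $T\notin\langle\nu(A')\rangle$ for every closed subscheme $A'\subsetneq A$. Then there is no zero-dimensional closed subscheme $B\subset Y$ of degree (length) $\deg(B)\le c$ with $T\in\langle\nu(B)\rangle$. Consequently the cactus rank of $T$ (the least degree of a zero-dimensional closed subscheme $Z\subset Y$ with $T\in\langle\nu(Z)\rangle$) is at least $c+1$, and so is the rank of $T$ (the least cardinality of a finite set of points $S\subset Y$ with $T\in\langle\nu(S)\rangle$). -/

import Mathlib

open scoped LinearAlgebra.Projectivization

noncomputable section

/-! Closed subschemes of a product of projective spaces `Y = ℙ^{n 0} × ⋯ × ℙ^{n (k-1)}` over `ℂ`,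
the cohomology of their twisted ideal sheaves, and their linear spans under the Segre map.

`Y` is covered by the affine charts `U_j = {x_{i, j i} ≠ 0 for all i}`. It is integral, so its
structure sheaf and the sheaves `𝒪(u)` have all their sections inside one field, and restriction
maps are inclusions. We take this field to be the fraction field of the Cox ring
`ℂ[x_{i,l} : i < k, 0 ≤ l ≤ n i]`. -/
namespace MultiProj

variable {k : ℕ} (n : Fin k → ℕ)

/-- The field `ℂ(x_{i,l})` of rational functions in all homogeneous coordinates. -/
abbrev RatField : Type := FractionRing (MvPolynomial (Σ i : Fin k, Fin (n i + 1)) ℂ)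

/-- The charts of `Y`: the choice of one coordinate on each factor. -/
abbrev Chart : Type := ∀ i : Fin k, Fin (n i + 1)

/-- The space `ℂ^{n 0 + 1} ⊗ ⋯ ⊗ ℂ^{n (k-1) + 1}` of tensors, whose projectivization `ℙ^M` is the
target of the Segre map. -/
abbrev TensorSpace : Type := PiTensorProduct ℂ (fun i : Fin k => Fin (n i + 1) → ℂ)

variable {n}

/-- The homogeneous coordinate `x_{i,l}`. -/
def coord (i : Fin k) (l : Fin (n i + 1)) : RatField n :=
  algebraMap (MvPolynomial (Σ i : Fin k, Fin (n i + 1)) ℂ) (RatField n) (MvPolynomial.X ⟨i, l⟩)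

/-- The ring `𝒪(U_j) = ℂ[x_{i,l} / x_{i, j i}]` of regular functions on the chart `U_j`. -/
def regular (j : Chart n) : Subalgebra ℂ (RatField n) :=
  Algebra.adjoin ℂ {a | ∃ (i : Fin k) (l : Fin (n i + 1)), a = coord i l / coord i (j i)}

/-- The ring `𝒪(U_j ∩ U_{j'})`, which is generated by `𝒪(U_j)` and `𝒪(U_{j'})`. -/
def regular₂ (j j' : Chart n) : Subalgebra ℂ (RatField n) := regular j ⊔ regular j'

/-- Restriction of regular functions from `U_j` to `U_j ∩ U_{j'}`. -/
def resL (j j' : Chart n) : regular j →ₐ[ℂ] regular₂ j j' :=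
  Subalgebra.inclusion le_sup_left

/-- Restriction of regular functions from `U_{j'}` to `U_j ∩ U_{j'}`. -/
def resR (j j' : Chart n) : regular j' →ₐ[ℂ] regular₂ j j' :=
  Subalgebra.inclusion le_sup_right

variable (n) in
/-- A closed subscheme of `Y`, given by its (quasi-coherent) ideal sheaf: an ideal of `𝒪(U_j)` for
every chart, such that the ideals of any two charts agree on the overlap. -/
@[ext]
structure ClosedSubscheme where
  ideal : ∀ j : Chart n, Ideal (regular j)
  compat : ∀ j j' : Chart n, (ideal j).map (resL j j') = (ideal j').map (resR j j')

/-- The local generator `∏_{i ∈ u} x_{i, j i}` of the line bundle `𝒪(u)` on `U_j`. -/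
def twist (u : Finset (Fin k)) (j : Chart n) : RatField n := ∏ i ∈ u, coord i (j i)

namespace ClosedSubscheme

variable (Z : ClosedSubscheme n)

/-- The ideal of `Z ∩ U_j ∩ U_{j'}`. -/
def ideal₂ (j j' : Chart n) : Ideal (regular₂ j j') := (Z.ideal j).map (resL j j')

/-- `Z` is zero-dimensional (or empty): its coordinate rings on the charts have Krull
dimension at most zero. -/
def IsZeroDimensional : Prop := ∀ j : Chart n, Ring.KrullDimLE 0 (regular j ⧸ Z.ideal j)

/-- `Z'` is a closed subscheme of `Z`, different from `Z`. -/
def IsProperSubscheme (Z' Z : ClosedSubscheme n) : Prop :=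
  (∀ j : Chart n, Z.ideal j ≤ Z'.ideal j) ∧ Z' ≠ Z

/-- The space `H⁰(Z, 𝒪_Z)` of global regular functions on `Z`: families of functions on the
`Z ∩ U_j` which agree on the `Z ∩ U_j ∩ U_{j'}`. -/
def globalFunctions : Submodule ℂ (∀ j : Chart n, regular j ⧸ Z.ideal j) :=
  ⨅ (j : Chart n) (j' : Chart n), LinearMap.eqLocus
    ((Ideal.quotientMapₐ (Z.ideal₂ j j') (resL j j') Ideal.le_comap_map).toLinearMap ∘ₗ
      LinearMap.proj j)
    ((Ideal.quotientMapₐ (Z.ideal₂ j j') (resR j j')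
      (Ideal.map_le_iff_le_comap.mp (Z.compat j j').ge)).toLinearMap ∘ₗ LinearMap.proj j')

/-- The degree (length) of a zero-dimensional scheme: the dimension of `H⁰(Z, 𝒪_Z)`. -/
def degree : ℕ := Module.finrank ℂ Z.globalFunctions

/-- The sections of `𝓘_Z(u) = 𝓘_Z ⊗ 𝒪(u)` on `U_j`. -/
def sections (u : Finset (Fin k)) (j : Chart n) : Submodule ℂ (RatField n) :=
  ((Z.ideal j).restrictScalars ℂ).map
    (LinearMap.mulLeft ℂ (twist u j) ∘ₗ (regular j).val.toLinearMap)

/-- The sections of `𝓘_Z(u)` on `U_j ∩ U_{j'}`. -/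
def sections₂ (u : Finset (Fin k)) (j j' : Chart n) : Submodule ℂ (RatField n) :=
  ((Z.ideal₂ j j').restrictScalars ℂ).map
    (LinearMap.mulLeft ℂ (twist u j) ∘ₗ (regular₂ j j').val.toLinearMap)

/-- `H⁰(Y, 𝓘_Z(u))`: restriction maps being inclusions, a global section is an element of the
ambient field that is a section on every chart. -/
def H0 (u : Finset (Fin k)) : Submodule ℂ (RatField n) := ⨅ j : Chart n, Z.sections u j

/-- Čech `1`-cocycles of `𝓘_Z(u)` for the affine open cover `(U_j)`. -/
def cocycles (u : Finset (Fin k)) : Submodule ℂ (Chart n → Chart n → RatField n) where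
  carrier := {φ | (∀ j j', φ j j' ∈ Z.sections₂ u j j') ∧
    ∀ j j' j'', φ j j' + φ j' j'' = φ j j''}
  zero_mem' := ⟨fun _ _ => Submodule.zero_mem _, fun _ _ _ => add_zero _⟩
  add_mem' := by
    rintro a b ⟨ha, ha'⟩ ⟨hb, hb'⟩
    refine ⟨fun j j' => Submodule.add_mem _ (ha j j') (hb j j'), fun j j' j'' => ?_⟩
    simp only [Pi.add_apply, ← ha' j j' j'', ← hb' j j' j'']
    ring
  smul_mem' := by
    rintro r a ⟨ha, ha'⟩
    refine ⟨fun j j' => Submodule.smul_mem _ r (ha j j'), fun j j' j'' => ?_⟩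
    simp only [Pi.smul_apply, ← ha' j j' j'', smul_add]

/-- Čech `1`-coboundaries of `𝓘_Z(u)` for the affine open cover `(U_j)`. -/
def coboundaries (u : Finset (Fin k)) : Submodule ℂ (Chart n → Chart n → RatField n) where
  carrier := {φ | ∃ s : Chart n → RatField n, (∀ j, s j ∈ Z.sections u j) ∧
    ∀ j j', φ j j' = s j' - s j}
  zero_mem' := ⟨0, fun _ => Submodule.zero_mem _, fun _ _ => (sub_zero _).symm⟩
  add_mem' := by
    rintro a b ⟨s, hs, hs'⟩ ⟨t, ht, ht'⟩
    refine ⟨s + t, fun j => Submodule.add_mem _ (hs j) (ht j), fun j j' => ?_⟩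
    simp only [Pi.add_apply, hs' j j', ht' j j']
    ring
  smul_mem' := by
    rintro r a ⟨s, hs, hs'⟩
    refine ⟨r • s, fun j => Submodule.smul_mem _ r (hs j), fun j j' => ?_⟩
    simp only [Pi.smul_apply, hs' j j', smul_sub]

/-- `H¹(Y, 𝓘_Z(u))`, computed as Čech cohomology for the affine open cover `(U_j)`. -/
abbrev H1 (u : Finset (Fin k)) : Type :=
  Z.cocycles u ⧸ (Z.coboundaries u).submoduleOf (Z.cocycles u)

/-- `h⁰(𝓘_Z(u))`. -/
def h0 (u : Finset (Fin k)) : Cardinal := Module.rank ℂ (Z.H0 u)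

/-- `h¹(𝓘_Z(u))`. -/
def h1 (u : Finset (Fin k)) : Cardinal := Module.rank ℂ (Z.H1 u)

end ClosedSubscheme

/-- The pullback under the Segre map of a linear form `ℓ` on the space of tensors: the multilinear
form `∑_j ℓ(e_{j 0} ⊗ ⋯ ⊗ e_{j (k-1)}) ∏_i x_{i, j i}`, the value of `ℓ` at the pure tensor
`⊗_i (∑_l x_{i,l} e_l)` with indeterminate coordinates. -/
def segrePullback : Module.Dual ℂ (TensorSpace n) →ₗ[ℂ] RatField n where
  toFun ℓ := ∑ j : Chart n,
    ℓ (PiTensorProduct.tprod ℂ fun i => Pi.single (j i) (1 : ℂ)) • twist Finset.univ j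
  map_add' ℓ ℓ' := by simp only [LinearMap.add_apply, add_smul, Finset.sum_add_distrib]
  map_smul' r ℓ := by
    simp only [LinearMap.smul_apply, smul_eq_mul, mul_smul, Finset.smul_sum, RingHom.id_apply]

/-- The linear span `⟨ν(Z)⟩`, as a linear subspace of the space of tensors: the intersection of the
hyperplanes `ℓ = 0` which contain `ν(Z)` as a scheme, that is, such that the pullback of `ℓ` is a
section of `𝓘_Z(1)`. -/
def ClosedSubscheme.linearSpan (Z : ClosedSubscheme n) : Submodule ℂ (TensorSpace n) :=
  ((Z.H0 Finset.univ).comap segrePullback).dualCoannihilator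

/-- The point `T` of `ℙ^M` lies in `⟨ν(Z)⟩`. -/
def ClosedSubscheme.SpanContains (Z : ClosedSubscheme n) (T : ℙ ℂ (TensorSpace n)) : Prop :=
  T.submodule ≤ Z.linearSpan

/-- The cactus rank of `T`: the least degree of a zero-dimensional scheme whose span under the Segre
map contains `T`. -/
def cactusRank (T : ℙ ℂ (TensorSpace n)) : ℕ∞ :=
  ⨅ (Z : ClosedSubscheme n) (_ : Z.IsZeroDimensional ∧ Z.SpanContains T), (Z.degree : ℕ∞)

/-- The rank of `T`: the least cardinality of a finite set of points of `Y` whose span under the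
Segre map contains `T`. -/
def tensorRank (T : ℙ ℂ (TensorSpace n)) : ℕ∞ :=
  ⨅ (S : Finset (∀ i : Fin k, ℙ ℂ (Fin (n i + 1) → ℂ)))
    (_ : T.submodule ≤ Submodule.span ℂ
      ((fun p : ∀ i : Fin k, ℙ ℂ (Fin (n i + 1) → ℂ) =>
        PiTensorProduct.tprod ℂ fun i => (p i).rep) '' (S : Set _))),
    (S.card : ℕ∞)

end MultiProj

end

/-!
Write `𝒪(1)` for `𝒪({1, …, k})`, so that `𝒪(1) = 𝒪(E) ⊗ 𝒪(F)`, and regard a representative of `T` as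
a functional on `H⁰(𝒪(1))`, the space of multilinear forms (`exists_segrePullback_eq`,
`mem_span_twist`). That `T` lies in the span of `Z` means that `T` kills `H⁰(𝓘_Z(1))`.

Suppose that `B` has degree at most `c`. Vanishing on `B` imposes at most `c` linear conditions on
the `M_F` multilinear monomials spanning `H⁰(𝒪(F))` (`exists_linearMap_globalFunctions`), whereas
`h⁰(𝓘_A(F)) < M_F - c`. So there is a form `G ∈ H⁰(𝒪(F))` which vanishes on `B` but not on `A`
(`exists_form_notMem_H0`). Then `A' = A ∩ {G = 0}` is strictly smaller than `A`, and by minimality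
`T` does not kill `H⁰(𝓘_{A'}(1))`. The crucial point (`exists_sub_mul_mem_H0`) is that
`H⁰(𝓘_{A'}(1)) = H⁰(𝓘_A(1)) + G · H⁰(𝒪(E))`, because `A` is zero-dimensional and
`h¹(𝓘_A(E)) = 0`. As `T` kills the first summand, there is `t ∈ H⁰(𝒪(E))` such that `T` does not
kill `G t` (`exists_segrePullback_eq_mul`). But `G t` vanishes on `B`, so `T` is not in the span
of `B`.

The bound on the cactus rank is the same statement. For the rank, the conditions "vanishing on `B`"
are replaced by vanishing at the given points, so the reduced scheme of these points is not needed.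

Everything takes place inside the field of rational functions in the coordinates `x_{i,l}`. Zero
dimensionality enters through `exists_generic_unit`: a general combination of the equations of the
complements of the charts is invertible on a zero-dimensional scheme.
-/

namespace MultiProj

variable {k : ℕ} {n : Fin k → ℕ}

/-! ### Laurent monomials and the global sections of `𝒪(u)` -/

lemma coord_ne_zero (i : Fin k) (l : Fin (n i + 1)) : coord (n := n) i l ≠ 0 := by
  unfold coord
  rw [Ne, FaithfulSMul.algebraMap_eq_zero_iff]
  exact MvPolynomial.X_ne_zero _

/-- The Laurent monomial `∏ x_{i,l} ^ a_{i,l}` as a rational function. -/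
noncomputable def laurent (a : (Σ i : Fin k, Fin (n i + 1)) → ℤ) : RatField n :=
  ∏ p, coord p.1 p.2 ^ a p

lemma laurent_zero : laurent (n := n) 0 = 1 := by simp [laurent]

lemma laurent_add (a b : (Σ i : Fin k, Fin (n i + 1)) → ℤ) :
    laurent (a + b) = laurent a * laurent b := by
  simp only [laurent, ← Finset.prod_mul_distrib, Pi.add_apply]
  exact Finset.prod_congr rfl fun p _ => zpow_add₀ (coord_ne_zero _ _) _ _

lemma laurent_natCast (a : (Σ i : Fin k, Fin (n i + 1)) →₀ ℕ) :
    laurent (fun p => (a p : ℤ)) =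
      algebraMap (MvPolynomial (Σ i : Fin k, Fin (n i + 1)) ℂ) (RatField n)
        (MvPolynomial.monomial a 1) := by
  rw [MvPolynomial.monomial_eq, map_mul, map_one, map_one, one_mul, Finsupp.prod_fintype _ _
    (fun _ => pow_zero _), map_prod]
  simp [laurent, coord]

lemma linearIndependent_laurent : LinearIndependent ℂ (laurent (n := n)) := by
  rw [linearIndependent_iff']
  intro S g hg a ha
  -- a common denominator of the Laurent monomials in `S`
  let b : (Σ i : Fin k, Fin (n i + 1)) → ℤ := fun p => ∑ a ∈ S, |a p|
  have hb : ∀ a ∈ S, ∀ p, 0 ≤ a p + b p := fun a ha p => by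
    have h1 : |a p| ≤ b p :=
      Finset.single_le_sum (f := fun a : (Σ i : Fin k, Fin (n i + 1)) → ℤ => |a p|)
        (fun _ _ => abs_nonneg _) ha
    have h2 := neg_abs_le (a p)
    linarith
  let e : ((Σ i : Fin k, Fin (n i + 1)) → ℤ) → ((Σ i : Fin k, Fin (n i + 1)) →₀ ℕ) :=
    fun a => Finsupp.equivFunOnFinite.symm fun p => (a p + b p).toNat
  have he : ∀ a ∈ S, laurent a * laurent b =
      algebraMap (MvPolynomial (Σ i : Fin k, Fin (n i + 1)) ℂ) (RatField n)
        (MvPolynomial.monomial (e a) 1) := fun a ha => by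
    rw [← laurent_add, ← laurent_natCast]
    congr 1
    funext p
    simp [e, Int.toNat_of_nonneg (hb a ha p)]
  have hinj : ∀ a' ∈ S, e a' = e a → a' = a := fun a' ha' h => by
    funext p
    have h1 : (a' p + b p).toNat = (a p + b p).toNat := by
      simpa [e] using DFunLike.congr_fun h p
    have h2 := hb a ha p
    have h3 := hb a' ha' p
    omega
  have hsum : (∑ a ∈ S, MvPolynomial.monomial (e a) (g a) :
      MvPolynomial (Σ i : Fin k, Fin (n i + 1)) ℂ) = 0 := by
    apply FaithfulSMul.algebraMap_injective _ (RatField n)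
    rw [map_zero, ← zero_mul (laurent b), ← hg, Finset.sum_mul, map_sum]
    refine Finset.sum_congr rfl fun a ha => ?_
    rw [smul_mul_assoc, he a ha, ← mul_one (g a), ← smul_eq_mul, ← MvPolynomial.smul_monomial,
      smul_eq_mul, mul_one]
    exact map_smul (IsScalarTower.toAlgHom ℂ (MvPolynomial (Σ i : Fin k, Fin (n i + 1)) ℂ)
      (RatField n)) _ _
  have hcoeff := congrArg (MvPolynomial.coeff (e a)) hsum
  rw [MvPolynomial.coeff_sum, MvPolynomial.coeff_zero, Finset.sum_eq_single a] at hcoeff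
  · simpa using hcoeff
  · intro a' ha' hne
    rw [MvPolynomial.coeff_monomial, if_neg fun h => hne (hinj a' ha' h)]
  · exact fun h => absurd ha h

lemma twist_ne_zero (u : Finset (Fin k)) (j : Chart n) : twist u j ≠ 0 :=
  Finset.prod_ne_zero_iff.mpr fun _ _ => coord_ne_zero _ _

/-- The exponent of the monomial `∏_{i ∈ u} x_{i, j i}`. -/
def twistExp (u : Finset (Fin k)) (j : Chart n) : (Σ i : Fin k, Fin (n i + 1)) → ℤ :=
  fun p => if p.1 ∈ u ∧ p.2 = j p.1 then 1 else 0

lemma laurent_twistExp (u : Finset (Fin k)) (j : Chart n) :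
    laurent (twistExp u j) = twist u j := by
  have h : ∀ p : (Σ i : Fin k, Fin (n i + 1)), coord p.1 p.2 ^ twistExp u j p =
      if p.1 ∈ u ∧ p.2 = j p.1 then coord p.1 p.2 else 1 := fun p => by
    unfold twistExp; split_ifs <;> simp
  simp only [laurent, h, twist]
  rw [Fintype.prod_sigma]
  rw [← Finset.prod_subset (Finset.subset_univ u)]
  · refine Finset.prod_congr rfl fun i hi => ?_
    simp [hi]
  · intro i _ hi
    simp [hi]

/-- The exponents of the monomials that occur in sections of `𝒪(u)` on the chart `U_j`: those of
multidegree `u` in which only the variables `x_{i, j i}` may have negative exponents. -/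
def chartExp (u : Finset (Fin k)) (j : Chart n) : Set ((Σ i : Fin k, Fin (n i + 1)) → ℤ) :=
  {a | (∀ i, ∑ l, a ⟨i, l⟩ = if i ∈ u then 1 else 0) ∧ ∀ i l, l ≠ j i → 0 ≤ a ⟨i, l⟩}

lemma laurent_single_sub_single (i : Fin k) (l m : Fin (n i + 1)) :
    laurent (n := n) (Pi.single ⟨i, l⟩ 1 - Pi.single ⟨i, m⟩ 1) = coord i l / coord i m := by
  have h : ∀ l, laurent (n := n) (Pi.single ⟨i, l⟩ 1) = coord i l := fun l => by
    rw [laurent, Finset.prod_eq_single ⟨i, l⟩ _ (by simp)]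
    · simp
    · intro p _ hp
      simp [Pi.single_eq_of_ne hp]
  rw [eq_div_iff (coord_ne_zero _ _), ← h m, ← laurent_add, sub_add_cancel, h]

lemma regular_le_span_laurent (j : Chart n) :
    Subalgebra.toSubmodule (regular j) ≤ Submodule.span ℂ (laurent '' chartExp ∅ j) := by
  rw [regular, Algebra.adjoin_eq_span]
  refine Submodule.span_mono fun x hx => ?_
  induction hx using Submonoid.closure_induction with
  | mem x hx =>
    obtain ⟨i, l, rfl⟩ := hx
    refine ⟨_, ⟨fun i' => ?_, fun i' l' hl' => ?_⟩, laurent_single_sub_single i l (j i)⟩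
    · have h : ∀ m : Fin (n i + 1), ∑ l' : Fin (n i' + 1),
          (Pi.single ⟨i, m⟩ 1 : (Σ i : Fin k, Fin (n i + 1)) → ℤ) ⟨i', l'⟩ =
            if i' = i then 1 else 0 := fun m => by
        by_cases hi : i' = i
        · subst hi
          rw [Finset.sum_eq_single m]
          · simp
          · intro l' _ hl'
            exact Pi.single_eq_of_ne (by simpa using hl') _
          · simp
        · rw [if_neg hi]
          refine Finset.sum_eq_zero fun l' _ => Pi.single_eq_of_ne ?_ _
          rintro h
          exact hi (congrArg Sigma.fst h)
      simp [Finset.sum_sub_distrib, h]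
    · have h1 : (Pi.single ⟨i, j i⟩ 1 : (Σ i : Fin k, Fin (n i + 1)) → ℤ) ⟨i', l'⟩ = 0 := by
        refine Pi.single_eq_of_ne ?_ _
        rintro h
        obtain ⟨rfl, h⟩ := Sigma.mk.inj_iff.mp h
        exact hl' (eq_of_heq h)
      rw [Pi.sub_apply, h1, sub_zero]
      exact (Pi.single_nonneg (α := fun _ : (Σ i : Fin k, Fin (n i + 1)) => ℤ)).mpr
        zero_le_one _
  | one => exact ⟨0, ⟨by simp, by simp⟩, laurent_zero⟩
  | mul x y _ _ hx hy =>
    obtain ⟨a, ha, rfl⟩ := hx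
    obtain ⟨b, hb, rfl⟩ := hy
    refine ⟨a + b, ⟨fun i => ?_, fun i l hl => ?_⟩, laurent_add a b⟩
    · simpa [Finset.sum_add_distrib] using by rw [ha.1, hb.1]; simp
    · exact add_nonneg (ha.2 i l hl) (hb.2 i l hl)

/-- A rational function which is a section of `𝒪(u)` on all charts is a multilinear form in the
groups of variables `(x_{i,l})_l`, `i ∈ u`. -/
lemma mem_span_twist {u : Finset (Fin k)} {x : RatField n}
    (hx : ∀ j, x / twist u j ∈ regular j) :
    x ∈ Submodule.span ℂ (Set.range (twist (n := n) u)) := by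
  have h1 : ∀ j, x ∈ Submodule.span ℂ (laurent '' chartExp u j) := fun j => by
    have h2 := Submodule.mem_map_of_mem (f := LinearMap.mulRight ℂ (twist u j))
      (regular_le_span_laurent j (hx j))
    rw [LinearMap.mulRight_apply, div_mul_cancel₀ _ (twist_ne_zero u j), Submodule.map_span] at h2
    refine Submodule.span_mono ?_ h2
    rintro _ ⟨_, ⟨a, ha, rfl⟩, rfl⟩
    refine ⟨a + twistExp u j, ⟨fun i => ?_, fun i l hl => ?_⟩, ?_⟩
    · simp only [Pi.add_apply, Finset.sum_add_distrib, ha.1]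
      by_cases hi : i ∈ u <;> simp [twistExp, hi]
    · refine add_nonneg (ha.2 i l hl) ?_
      unfold twistExp; split_ifs <;> simp
    · rw [laurent_add, laurent_twistExp, LinearMap.mulRight_apply]
  have h3 : x ∈ Submodule.map (Finsupp.linearCombination ℂ (laurent (n := n)))
      (⨅ j, Finsupp.supported ℂ ℂ (chartExp u j)) := by
    have h4 := h1 (fun _ => 0)
    rw [Finsupp.mem_span_image_iff_linearCombination] at h4
    obtain ⟨f, -, rfl⟩ := h4
    refine ⟨f, ?_, rfl⟩
    simp only [SetLike.mem_coe, Submodule.mem_iInf]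
    intro j
    have h5 := h1 j
    rw [Finsupp.mem_span_image_iff_linearCombination] at h5
    obtain ⟨f', hf', h⟩ := h5
    rwa [← linearIndependent_laurent h]
  rw [← Finsupp.supported_iInter, ← Finsupp.span_image_eq_map_linearCombination] at h3
  refine Submodule.span_mono ?_ h3
  rintro _ ⟨a, ha, rfl⟩
  rw [Set.mem_iInter] at ha
  have hdeg := (ha fun _ => 0).1
  have hpos : ∀ i l, 0 ≤ a ⟨i, l⟩ := fun i l => by
    by_cases h : ∃ m, m ≠ l
    · obtain ⟨m, hm⟩ := h
      refine (ha (Function.update (fun _ => 0) i m)).2 i l ?_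
      simpa using hm.symm
    · push Not at h
      -- on a factor `ℙ⁰` the exponent of the only variable is given by the degree
      have h6 := hdeg i
      rw [Finset.sum_eq_single l (fun m _ hm => absurd (h m) hm) (by simp)] at h6
      rw [h6]; split_ifs <;> simp
  have hex : ∀ i, ∃ l, i ∈ u → a ⟨i, l⟩ = 1 ∧ ∀ m, m ≠ l → a ⟨i, m⟩ = 0 := fun i => by
    by_cases hi : i ∈ u
    · have h7 := hdeg i
      rw [if_pos hi] at h7
      obtain ⟨l, hl⟩ : ∃ l, a ⟨i, l⟩ ≠ 0 := by
        by_contra! h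
        simp [h] at h7
      refine ⟨l, fun _ => ?_⟩
      rw [← Finset.add_sum_erase _ _ (Finset.mem_univ l)] at h7
      have h8 := hpos i l
      have h9 : 0 ≤ ∑ m ∈ Finset.univ.erase l, a ⟨i, m⟩ :=
        Finset.sum_nonneg fun m _ => hpos i m
      have h10 : ∑ m ∈ Finset.univ.erase l, a ⟨i, m⟩ = 0 := by omega
      rw [Finset.sum_eq_zero_iff_of_nonneg fun m _ => hpos i m] at h10
      exact ⟨by omega, fun m hm => h10 m (by simp [hm])⟩
    · exact ⟨0, fun h => absurd h hi⟩
  choose j hj using hex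
  refine ⟨j, ?_⟩
  rw [← laurent_twistExp]
  congr 1
  funext ⟨i, l⟩
  by_cases hi : i ∈ u
  · by_cases hl : l = j i
    · simp [twistExp, hi, hl, (hj i hi).1]
    · simp [twistExp, hl, (hj i hi).2 l hl]
  · have h7 := hdeg i
    rw [if_neg hi, Finset.sum_eq_zero_iff_of_nonneg fun m _ => hpos i m] at h7
    simp [twistExp, hi, h7 l]

/-- Extension by `0` of a choice of coordinates on the factors in `u` to a chart of `Y`. -/
def extendChart (u : Finset (Fin k)) (a : ∀ i : u, Fin (n i + 1)) : Chart n :=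
  fun i => if h : i ∈ u then a ⟨i, h⟩ else 0

lemma linearIndependent_twist_extendChart (u : Finset (Fin k)) :
    LinearIndependent ℂ fun a : (∀ i : u, Fin (n i + 1)) => twist u (extendChart u a) := by
  simp_rw [← laurent_twistExp]
  refine linearIndependent_laurent.comp _ fun a b h => ?_
  funext ⟨i, hi⟩
  have h1 := congrFun h ⟨i, a ⟨i, hi⟩⟩
  simp only [twistExp, hi, extendChart, dif_pos, true_and, if_true] at h1
  by_contra hne
  rw [if_neg hne] at h1
  exact one_ne_zero h1

/-! ### The Segre pullback -/

lemma dual_tprod_eq_sum (ℓ : Module.Dual ℂ (TensorSpace n)) (v : ∀ i, Fin (n i + 1) → ℂ) :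
    ℓ (PiTensorProduct.tprod ℂ v) =
      ∑ j : Chart n, ℓ (PiTensorProduct.tprod ℂ fun i => Pi.single (j i) (1 : ℂ)) *
        ∏ i, v i (j i) := by
  have hv : v = fun i => ∑ l, v i l • (Pi.single l 1 : Fin (n i + 1) → ℂ) := by
    funext i
    exact pi_eq_sum_univ' (v i)
  conv_lhs => rw [hv, MultilinearMap.map_sum, map_sum]
  refine Finset.sum_congr rfl fun j _ => ?_
  rw [MultilinearMap.map_smul_univ, map_smul, smul_eq_mul, mul_comm]

/-- Every multilinear form is the Segre pullback of a linear form. -/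
lemma exists_segrePullback_eq {x : RatField n}
    (hx : x ∈ Submodule.span ℂ (Set.range (twist (n := n) Finset.univ))) :
    ∃ ℓ, segrePullback ℓ = x := by
  rw [← LinearMap.mem_range]
  refine Submodule.span_le.mpr ?_ hx
  rintro _ ⟨j, rfl⟩
  refine ⟨PiTensorProduct.lift ((MultilinearMap.mkPiAlgebra ℂ (Fin k) ℂ).compLinearMap
    fun i => LinearMap.proj (j i)), ?_⟩
  have h : ∀ j' : Chart n, PiTensorProduct.lift
      ((MultilinearMap.mkPiAlgebra ℂ (Fin k) ℂ).compLinearMap fun i => LinearMap.proj (R := ℂ) (φ := fun _ : Fin (n i + 1) => ℂ) (j i))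
        (PiTensorProduct.tprod ℂ fun i => Pi.single (j' i) (1 : ℂ)) = if j' = j then 1 else 0 := by
    intro j'
    rw [PiTensorProduct.lift.tprod]
    simp only [MultilinearMap.compLinearMap_apply, MultilinearMap.mkPiAlgebra_apply,
      LinearMap.proj_apply]
    split_ifs with hj
    · subst hj; simp
    · obtain ⟨i, hi⟩ := Function.ne_iff.mp hj
      exact Finset.prod_eq_zero (Finset.mem_univ i) (Pi.single_eq_of_ne (Ne.symm hi) _)
  simp only [segrePullback, LinearMap.coe_mk, AddHom.coe_mk, h, ite_smul, one_smul, zero_smul,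
    Finset.sum_ite_eq', Finset.mem_univ, if_true]

/-- The multilinear monomial `∏_{i ∈ u} x_{i, j i}` as a polynomial. -/
noncomputable def twistPoly (u : Finset (Fin k)) (j : Chart n) :
    MvPolynomial (Σ i : Fin k, Fin (n i + 1)) ℂ :=
  ∏ i ∈ u, MvPolynomial.X ⟨i, j i⟩

lemma toAlgHom_twistPoly (u : Finset (Fin k)) (j : Chart n) :
    IsScalarTower.toAlgHom ℂ (MvPolynomial (Σ i : Fin k, Fin (n i + 1)) ℂ) (RatField n)
      (twistPoly u j) = twist u j := by
  simp [twistPoly, twist, coord]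

lemma eval_twistPoly (v : ∀ i, Fin (n i + 1) → ℂ) (u : Finset (Fin k)) (j : Chart n) :
    MvPolynomial.eval (fun p => v p.1 p.2) (twistPoly u j) = ∏ i ∈ u, v i (j i) := by
  simp [twistPoly]

/-- If the pullback of `ℓ` is divisible, among multilinear forms, by a form vanishing at a point
of `Y`, then `ℓ` vanishes at the image of this point. -/
lemma dual_tprod_eq_zero {u u' : Finset (Fin k)} {ι : Type*} [Fintype ι] (w : ι → ℂ)
    (φ : ι → Chart n) {t : RatField n} (ht : t ∈ Submodule.span ℂ (Set.range (twist (n := n) u')))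
    {ℓ : Module.Dual ℂ (TensorSpace n)}
    (hℓ : segrePullback ℓ = (∑ a, w a • twist u (φ a)) * t) (v : ∀ i, Fin (n i + 1) → ℂ)
    (hv : ∑ a, w a * ∏ i ∈ u, v i (φ a i) = 0) : ℓ (PiTensorProduct.tprod ℂ v) = 0 := by
  set Φ := IsScalarTower.toAlgHom ℂ (MvPolynomial (Σ i : Fin k, Fin (n i + 1)) ℂ) (RatField n)
    with hΦ
  obtain ⟨t', rfl⟩ : ∃ t', Φ t' = t := by
    change t ∈ LinearMap.range Φ.toLinearMap
    refine Submodule.span_le.mpr ?_ ht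
    rintro _ ⟨j, rfl⟩
    exact ⟨twistPoly u' j, toAlgHom_twistPoly u' j⟩
  have h : ∑ j : Chart n, ℓ (PiTensorProduct.tprod ℂ fun i => Pi.single (j i) (1 : ℂ)) •
      twistPoly Finset.univ j = (∑ a, w a • twistPoly u (φ a)) * t' := by
    apply FaithfulSMul.algebraMap_injective _ (RatField n)
    change Φ _ = Φ _
    rw [map_mul, map_sum, map_sum]
    simp only [map_smul, hΦ, toAlgHom_twistPoly]
    rw [← hΦ, ← hℓ]
    rfl
  have h1 := congrArg (MvPolynomial.eval fun p => v p.1 p.2) h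
  simp only [map_sum, map_mul, MvPolynomial.smul_eval, eval_twistPoly, hv, zero_mul] at h1
  rw [dual_tprod_eq_sum, h1]

/-! ### Ideals of subalgebras of a field -/

section Subalgebra

variable {K : Type*} [Field K] [Algebra ℂ K] {S S' : Subalgebra ℂ K}

/-- An ideal of a subalgebra of the field `K`, as a submodule of `K`. -/
def idealIn (I : Ideal S) : Submodule S K := Submodule.map (Algebra.linearMap S K) I

lemma mem_idealIn {I : Ideal S} {x : K} : x ∈ idealIn I ↔ ∃ y ∈ I, (y : K) = x := Iff.rfl

lemma coe_mem_idealIn {I : Ideal S} {y : S} : (y : K) ∈ idealIn I ↔ y ∈ I := by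
  rw [mem_idealIn]
  exact ⟨fun ⟨z, hz, h⟩ => Subtype.ext h ▸ hz, fun h => ⟨y, h, rfl⟩⟩

lemma mem_of_mem_idealIn {I : Ideal S} {x : K} (hx : x ∈ idealIn I) : x ∈ S := by
  obtain ⟨y, -, rfl⟩ := mem_idealIn.mp hx
  exact y.2

lemma mul_mem_idealIn {I : Ideal S} {r x : K} (hr : r ∈ S) (hx : x ∈ idealIn I) :
    r * x ∈ idealIn I :=
  (idealIn I).smul_mem ⟨r, hr⟩ hx

lemma smul_mem_idealIn {I : Ideal S} (r : ℂ) {x : K} (hx : x ∈ idealIn I) :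
    r • x ∈ idealIn I := by
  rw [Algebra.smul_def]
  exact mul_mem_idealIn (Subalgebra.algebraMap_mem _ r) hx

lemma mem_idealIn_map {I : Ideal S} (h : S ≤ S') {x : K} (hx : x ∈ idealIn I) :
    x ∈ idealIn (I.map (Subalgebra.inclusion h)) := by
  obtain ⟨y, hy, rfl⟩ := mem_idealIn.mp hx
  exact mem_idealIn.mpr ⟨Subalgebra.inclusion h y, Ideal.mem_map_of_mem _ hy, rfl⟩

/-- If all elements of `S'` lie in `S` after multiplication with a power of `d`, then the elements of
the extension of an ideal `I` of `S` to `S'` lie in `I` after multiplication with a power of `d`. -/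
lemma exists_pow_mul_mem_idealIn {I : Ideal S} (h : S ≤ S') {d : K} (hd : d ∈ S)
    (hS : ∀ r ∈ S', ∃ N : ℕ, d ^ N * r ∈ S) {x : K}
    (hx : x ∈ idealIn (I.map (Subalgebra.inclusion h))) : ∃ N : ℕ, d ^ N * x ∈ idealIn I := by
  obtain ⟨y, hy, rfl⟩ := mem_idealIn.mp hx
  clear hx
  induction hy using Submodule.span_induction with
  | mem y hy =>
    obtain ⟨z, hz, rfl⟩ := hy
    exact ⟨0, mem_idealIn.mpr ⟨z, hz, by simp⟩⟩
  | zero => exact ⟨0, by simp⟩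
  | add y z _ _ hy hz =>
    obtain ⟨N, hN⟩ := hy
    obtain ⟨M, hM⟩ := hz
    refine ⟨N + M, ?_⟩
    have h : d ^ (N + M) * ((y + z : S') : K) = d ^ M * (d ^ N * y) + d ^ N * (d ^ M * z) := by
      push_cast; ring
    rw [h]
    exact add_mem (mul_mem_idealIn (pow_mem hd _) hN) (mul_mem_idealIn (pow_mem hd _) hM)
  | smul r y _ hy =>
    obtain ⟨N, hN⟩ := hy
    obtain ⟨M, hM⟩ := hS r r.2
    refine ⟨M + N, ?_⟩
    have h : d ^ (M + N) * ((r • y : S') : K) = (d ^ M * r) * (d ^ N * y) := by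
      rw [smul_eq_mul]; push_cast; ring
    rw [h]
    exact mul_mem_idealIn hM hN

lemma mem_map_mulLeft_iff {I : Ideal S} {t x : K} (ht : t ≠ 0) :
    x ∈ (I.restrictScalars ℂ).map (LinearMap.mulLeft ℂ t ∘ₗ S.val.toLinearMap) ↔
      x / t ∈ idealIn I := by
  rw [mem_idealIn]
  constructor
  · rintro ⟨y, hy, rfl⟩
    exact ⟨y, hy, by simp [mul_div_cancel_left₀ _ ht]⟩
  · rintro ⟨y, hy, h⟩
    refine ⟨y, hy, ?_⟩
    rw [eq_div_iff ht, mul_comm] at h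
    exact h

/-- If `γ' = γ δ`, then inverses `v` of `γ` and `v'` of `γ'` modulo `I` satisfy `v = v' δ` modulo `I`.
Applied to the local expressions `γ`, `γ'` of a nowhere vanishing section of a line bundle with
transition function `δ`. -/
lemma inverse_transition {I : Ideal S} {γ γ' v v' δ : K} (hv : v ∈ S) (hv' : v' ∈ S)
    (h : v * γ - 1 ∈ idealIn I) (h' : v' * γ' - 1 ∈ idealIn I) (hδ : δ ∈ S)
    (hγ : γ' = γ * δ) : v' * δ - v ∈ idealIn I := by
  have e : v' * δ - v = v * (v' * γ' - 1) - (v' * δ) * (v * γ - 1) := by rw [hγ]; ring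
  rw [e]
  exact sub_mem (mul_mem_idealIn hv h') (mul_mem_idealIn (mul_mem hv' hδ) h)

end Subalgebra

/-! ### Local ideals inside the field of rational functions -/

lemma coord_div_mem_regular (i : Fin k) (l : Fin (n i + 1)) (j : Chart n) :
    coord i l / coord i (j i) ∈ regular j :=
  Algebra.subset_adjoin ⟨i, l, rfl⟩

lemma twist_div_mem_regular (u : Finset (Fin k)) (j j' : Chart n) :
    twist u j / twist u j' ∈ regular j' := by
  rw [twist, twist, ← Finset.prod_div_distrib]
  exact Subalgebra.prod_mem _ fun i _ => coord_div_mem_regular i (j i) j'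

lemma regular_le_left (j j' : Chart n) : regular j ≤ regular₂ j j' := le_sup_left

lemma regular_le_right (j j' : Chart n) : regular j' ≤ regular₂ j j' := le_sup_right

/-- Functions on `U_j ∩ U_{j'}` extend to `U_{j'}` after multiplication with a power of the
equation of the complement of `U_j`. -/
lemma exists_pow_mul_mem_regular {j j' : Chart n} {x : RatField n} (hx : x ∈ regular₂ j j') :
    ∃ N : ℕ, (twist Finset.univ j / twist Finset.univ j') ^ N * x ∈ regular j' := by
  have hd := twist_div_mem_regular Finset.univ j j'
  set d := twist Finset.univ j / twist Finset.univ j' with hd_def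
  rw [regular₂, regular, regular, ← Algebra.adjoin_union] at hx
  induction hx using Algebra.adjoin_induction with
  | mem x hx =>
    rcases hx with ⟨i, l, rfl⟩ | ⟨i, l, rfl⟩
    · refine ⟨1, ?_⟩
      have h : d ^ 1 * (coord i l / coord i (j i)) =
          (twist (Finset.univ.erase i) j / twist (Finset.univ.erase i) j') *
            (coord i l / coord i (j' i)) := by
        have h1 : ∀ j : Chart n,
            twist Finset.univ j = coord i (j i) * twist (Finset.univ.erase i) j :=
          fun j => (Finset.mul_prod_erase _ (fun i => coord i (j i)) (Finset.mem_univ i)).symm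
        have h2 := coord_ne_zero i (j i)
        have h3 := coord_ne_zero i (j' i)
        have h4 := twist_ne_zero (Finset.univ.erase i) j'
        rw [hd_def, h1 j, h1 j', pow_one]
        field_simp
      rw [h]
      exact mul_mem (twist_div_mem_regular _ j j') (coord_div_mem_regular i l j')
    · exact ⟨0, by simpa using coord_div_mem_regular i l j'⟩
  | algebraMap r => exact ⟨0, by simp⟩
  | add x y _ _ hx hy =>
    obtain ⟨N, hN⟩ := hx
    obtain ⟨M, hM⟩ := hy
    refine ⟨N + M, ?_⟩
    have h : d ^ (N + M) * (x + y) = d ^ M * (d ^ N * x) + d ^ N * (d ^ M * y) := by ring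
    rw [h]
    exact add_mem (mul_mem (pow_mem hd _) hN) (mul_mem (pow_mem hd _) hM)
  | mul x y _ _ hx hy =>
    obtain ⟨N, hN⟩ := hx
    obtain ⟨M, hM⟩ := hy
    refine ⟨N + M, ?_⟩
    have h : d ^ (N + M) * (x * y) = (d ^ N * x) * (d ^ M * y) := by ring
    rw [h]
    exact mul_mem hN hM

namespace ClosedSubscheme

variable (Z : ClosedSubscheme n)

/-- The ideal of `Z ∩ U_j` in `𝒪(U_j)`, as a set of rational functions. -/
noncomputable abbrev loc (j : Chart n) : Submodule (regular j) (RatField n) := idealIn (Z.ideal j)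

/-- The ideal of `Z ∩ U_j ∩ U_{j'}` in `𝒪(U_j ∩ U_{j'})`, as a set of rational functions. -/
noncomputable abbrev loc₂ (j j' : Chart n) : Submodule (regular₂ j j') (RatField n) :=
  idealIn (Z.ideal₂ j j')

variable {Z} {j j' : Chart n}

lemma loc_le_left {x : RatField n} (hx : x ∈ Z.loc j) : x ∈ Z.loc₂ j j' :=
  mem_idealIn_map (regular_le_left j j') hx

lemma ideal₂_eq (j j' : Chart n) : Z.ideal₂ j j' = (Z.ideal j').map (resR j j') :=
  Z.compat j j'

lemma loc_le_right {x : RatField n} (hx : x ∈ Z.loc j') : x ∈ Z.loc₂ j j' := by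
  rw [loc₂, ideal₂_eq]
  exact mem_idealIn_map (regular_le_right j j') hx

lemma mem_sections {u : Finset (Fin k)} {x : RatField n} :
    x ∈ Z.sections u j ↔ x / twist u j ∈ Z.loc j :=
  mem_map_mulLeft_iff (twist_ne_zero u j)

lemma mem_sections₂ {u : Finset (Fin k)} {x : RatField n} :
    x ∈ Z.sections₂ u j j' ↔ x / twist u j ∈ Z.loc₂ j j' :=
  mem_map_mulLeft_iff (twist_ne_zero u j)

lemma mem_H0 {u : Finset (Fin k)} {x : RatField n} :
    x ∈ Z.H0 u ↔ ∀ j, x / twist u j ∈ Z.loc j := by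
  simp only [H0, Submodule.mem_iInf, mem_sections]

/-- Sections of the ideal sheaf on `U_j ∩ U_{j'}` extend to `U_{j'}` after multiplication with a
high power of the equation of the complement of `U_j`. -/
lemma exists_pow_mul_mem_loc {x : RatField n} (hx : x ∈ Z.loc₂ j j') :
    ∃ N : ℕ, (twist Finset.univ j / twist Finset.univ j') ^ N * x ∈ Z.loc j' := by
  rw [loc₂, ideal₂_eq] at hx
  exact exists_pow_mul_mem_idealIn (regular_le_right j j')
    (twist_div_mem_regular Finset.univ j j') (fun _ hr => exists_pow_mul_mem_regular hr) hx

/-! ### Sections that do not vanish on a zero-dimensional scheme -/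

/-- Given finitely many algebras with finitely many maximal ideals each, and a family of elements
`y j i` of the `j`-th one with `y j j = 1`, a general linear combination `∑ i, c i • y j i` is a unit
for all `j`: a complex vector space is not a finite union of proper subspaces. -/
lemma exists_sum_smul_isUnit {ι : Type*} [Fintype ι] [DecidableEq ι] {R : ι → Type*}
    [∀ j, CommRing (R j)] [∀ j, Algebra ℂ (R j)] [∀ j, Finite (MaximalSpectrum (R j))]
    (y : ∀ j, ι → R j) (hy : ∀ j, y j j = 1) :
    ∃ c : ι → ℂ, ∀ j, IsUnit (∑ i, c i • y j i) := by
  let p : (Σ j, MaximalSpectrum (R j)) → Submodule ℂ (ι → ℂ) :=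
    fun q => (q.2.asIdeal.restrictScalars ℂ).comap (Fintype.linearCombination ℂ (y q.1))
  have hp : ∀ q, p q ≠ ⊤ := by
    rintro ⟨j, m⟩ h
    have h1 : Pi.single j (1 : ℂ) ∈ p ⟨j, m⟩ := h ▸ Submodule.mem_top
    have h4 : Fintype.linearCombination ℂ (y j) (Pi.single j (1 : ℂ)) ∈ m.asIdeal := h1
    rw [Fintype.linearCombination_apply_single, one_smul, hy] at h4
    exact m.isMaximal.ne_top ((Ideal.eq_top_iff_one _).mpr h4)
  obtain ⟨c, hc⟩ : ∃ c, ∀ q, c ∉ p q := by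
    by_contra! h
    obtain ⟨q, hq⟩ := Subspace.exists_eq_top_of_iUnion_eq_univ (p := p)
      (Set.eq_univ_of_forall fun c => Set.mem_iUnion.mpr (h c))
    exact hp q hq
  refine ⟨c, fun j => ?_⟩
  by_contra h
  obtain ⟨m, hm, hmem⟩ := exists_max_ideal_of_mem_nonunits h
  exact hc ⟨j, ⟨m, hm⟩⟩ hmem

lemma finiteType_regular (j : Chart n) : Algebra.FiniteType ℂ (regular j) := by
  rw [← Subalgebra.fg_iff_finiteType, Subalgebra.fg_def]
  refine ⟨_, ?_, rfl⟩
  have h : {a | ∃ (i : Fin k) (l : Fin (n i + 1)), a = coord i l / coord i (j i)} =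
      Set.range fun p : (Σ i : Fin k, Fin (n i + 1)) => coord p.1 p.2 / coord p.1 (j p.1) := by
    ext a
    constructor
    · rintro ⟨i, l, rfl⟩
      exact ⟨⟨i, l⟩, rfl⟩
    · rintro ⟨⟨i, l⟩, rfl⟩
      exact ⟨i, l, rfl⟩
  rw [h]
  exact Set.finite_range _

lemma finite_quotient_of_krullDimLE {R : Type*} [CommRing R] [Algebra ℂ R]
    [Algebra.FiniteType ℂ R] {I : Ideal R} (hI : Ring.KrullDimLE 0 (R ⧸ I)) :
    Module.Finite ℂ (R ⧸ I) :=
  (Module.finite_iff_krullDimLE_zero ℂ (R ⧸ I)).mpr hI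

/-- A version of `exists_sum_smul_isUnit` for zero-dimensional quotients `R j ⧸ I j` of finitely
generated algebras, in terms of representatives `y j i` and of an inverse `v j` modulo `I j`. -/
lemma exists_sum_smul_inverse {ι : Type*} [Fintype ι] [DecidableEq ι] {R : ι → Type*}
    [∀ j, CommRing (R j)] [∀ j, Algebra ℂ (R j)] [∀ j, Algebra.FiniteType ℂ (R j)]
    (I : ∀ j, Ideal (R j)) (hI : ∀ j, Ring.KrullDimLE 0 (R j ⧸ I j))
    (y : ∀ j, ι → R j) (hy : ∀ j, y j j = 1) :
    ∃ (c : ι → ℂ) (v : ∀ j, R j), ∀ j, v j * (∑ i, c i • y j i) - 1 ∈ I j := by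
  have hfin : ∀ j, Finite (MaximalSpectrum (R j ⧸ I j)) := fun j => by
    have := finite_quotient_of_krullDimLE (hI j)
    have : IsArtinianRing (R j ⧸ I j) := isArtinian_of_tower ℂ inferInstance
    infer_instance
  obtain ⟨c, hc⟩ := exists_sum_smul_isUnit (fun j i => Ideal.Quotient.mkₐ ℂ (I j) (y j i))
    fun j => by rw [hy, map_one]
  have hinv : ∀ j, ∃ v : R j, v * (∑ i, c i • y j i) - 1 ∈ I j := fun j => by
    obtain ⟨w, hw⟩ := (hc j).exists_left_inv
    obtain ⟨v, rfl⟩ := Ideal.Quotient.mkₐ_surjective ℂ (I j) w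
    refine ⟨v, ?_⟩
    have h : Ideal.Quotient.mkₐ ℂ (I j) (v * (∑ i, c i • y j i) - 1) = 0 := by
      rw [map_sub, map_mul, map_sum, map_one, sub_eq_zero]
      simpa only [map_smul] using hw
    exact Ideal.Quotient.eq_zero_iff_mem.mp h
  choose v hv using hinv
  exact ⟨c, v, hv⟩

lemma finite_quotient (hZ : Z.IsZeroDimensional) (j : Chart n) :
    Module.Finite ℂ (regular j ⧸ Z.ideal j) := by
  have := finiteType_regular j
  exact finite_quotient_of_krullDimLE (hZ j)

/-- On a zero-dimensional scheme `Z`, a general linear combination of the `N`-th powers of the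
monomials `twist u j` is a nowhere vanishing section of `𝒪(u)^N`: on each chart, its quotient by
the local generator has an inverse `v` modulo the ideal of `Z`. -/
lemma exists_generic_unit (hZ : Z.IsZeroDimensional) (u : Finset (Fin k)) (N : ℕ) :
    ∃ (c : Chart n → ℂ) (v : Chart n → RatField n), ∀ j', v j' ∈ regular j' ∧
      v j' * (∑ j, c j • (twist u j / twist u j') ^ N) - 1 ∈ Z.loc j' := by
  have := finiteType_regular (n := n)
  let y : ∀ j', Chart n → regular j' :=
    fun j' j => ⟨(twist u j / twist u j') ^ N, pow_mem (twist_div_mem_regular u j j') N⟩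
  obtain ⟨c, v, hv⟩ := exists_sum_smul_inverse Z.ideal hZ y fun j =>
    Subtype.ext (by simp [y, div_self (twist_ne_zero u j)])
  refine ⟨c, fun j => v j, fun j => ⟨(v j).2, ?_⟩⟩
  have h := coe_mem_idealIn.mpr (hv j)
  have e : ((∑ i, c i • y j i : regular j) : RatField n) =
      ∑ i, c i • (twist u i / twist u j) ^ N := by
    rw [AddSubmonoidClass.coe_finsetSum]
    rfl
  rw [← e]
  exact h

lemma sum_pow_twist_div (u : Finset (Fin k)) (N : ℕ) (c : Chart n → ℂ) (j j' : Chart n) :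
    ∑ i, c i • (twist u i / twist u j') ^ N =
      (∑ i, c i • (twist u i / twist u j) ^ N) * (twist u j / twist u j') ^ N := by
  rw [Finset.sum_mul]
  refine Finset.sum_congr rfl fun i _ => ?_
  rw [smul_mul_assoc, ← mul_pow, div_mul_div_cancel₀ (twist_ne_zero u j)]

end ClosedSubscheme

/-! ### Hypersurface sections of a zero-dimensional scheme -/

section Subalgebra

variable {K : Type*} [Field K] [Algebra ℂ K] {S : Subalgebra ℂ K}

lemma span_singleton_eq_of_mul_eq {x y : S} {a b : K} (ha : a ∈ S) (hb : b ∈ S)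
    (hx : (y : K) * a = x) (hy : (x : K) * b = y) :
    Ideal.span {x} = Ideal.span {y} :=
  le_antisymm
    (Ideal.span_singleton_le_span_singleton.mpr ⟨⟨a, ha⟩, Subtype.ext hx.symm⟩)
    (Ideal.span_singleton_le_span_singleton.mpr ⟨⟨b, hb⟩, Subtype.ext hy.symm⟩)

lemma exists_of_mem_idealIn_sup_span {I : Ideal S} {g : S} {x : K}
    (hx : x ∈ idealIn (I ⊔ Ideal.span {g})) :
    ∃ a ∈ idealIn I, ∃ t ∈ S, x = a + g * t := by
  obtain ⟨y, hy, rfl⟩ := mem_idealIn.mp hx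
  obtain ⟨a, ha, b, hb, rfl⟩ := Submodule.mem_sup.mp hy
  obtain ⟨t, rfl⟩ := Ideal.mem_span_singleton.mp hb
  exact ⟨a, coe_mem_idealIn.mpr ha, t, t.2, by push_cast; rfl⟩

end Subalgebra

lemma twist_eq_mul {E F : Finset (Fin k)} (hdisj : Disjoint E F) (hcover : E ∪ F = Finset.univ)
    (j : Chart n) : twist Finset.univ j = twist E j * twist F j := by
  rw [twist, ← hcover, Finset.prod_union hdisj]
  rfl

namespace ClosedSubscheme

variable {Z : ClosedSubscheme n} {E F u : Finset (Fin k)} {G : RatField n}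

variable (Z) in
/-- The closed subscheme `Z ∩ {G = 0}`, for a section `G` of `𝒪(u)`. -/
noncomputable def inter (hG : ∀ j, G / twist u j ∈ regular j) : ClosedSubscheme n where
  ideal j := Z.ideal j ⊔ Ideal.span {⟨G / twist u j, hG j⟩}
  compat j j' := by
    rw [Ideal.map_sup, Ideal.map_sup, Z.compat, Ideal.map_span, Ideal.map_span,
      Set.image_singleton, Set.image_singleton]
    congr 1
    refine span_singleton_eq_of_mul_eq (a := twist u j' / twist u j) (b := twist u j / twist u j')
      (regular_le_left j j' (twist_div_mem_regular u j' j))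
      (regular_le_right j j' (twist_div_mem_regular u j j')) ?_ ?_
    · exact div_mul_div_cancel₀ (twist_ne_zero u j')
    · exact div_mul_div_cancel₀ (twist_ne_zero u j)

lemma inter_isProperSubscheme (hG : ∀ j, G / twist u j ∈ regular j) (hGZ : G ∉ Z.H0 u) :
    (Z.inter hG).IsProperSubscheme Z := by
  refine ⟨fun j => le_sup_left, fun h => hGZ (mem_H0.mpr fun j => ?_)⟩
  have h1 : (⟨G / twist u j, hG j⟩ : regular j) ∈ (Z.inter hG).ideal j :=
    Ideal.mem_sup_right (Ideal.mem_span_singleton_self _)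
  rw [h] at h1
  exact coe_mem_idealIn.mpr h1

lemma mem_coboundaries_of_h1_eq_zero (h : Z.h1 u = 0) {φ : Chart n → Chart n → RatField n}
    (hφ : φ ∈ Z.cocycles u) : φ ∈ Z.coboundaries u := by
  have h1 : Subsingleton (Z.H1 u) := rank_zero_iff.mp h
  exact (Submodule.Quotient.mk_eq_zero ((Z.coboundaries u).submoduleOf (Z.cocycles u))
    (x := ⟨φ, hφ⟩)).mp (h1.elim _ _)

/-- A power of the coordinates that clears denominators on all overlaps at once. -/
lemma exists_uniform_pow {a t : Chart n → RatField n} (ha : ∀ j, a j ∈ Z.loc j)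
    (ht : ∀ j, t j ∈ regular j) :
    ∃ N : ℕ, ∀ j j', (twist Finset.univ j / twist Finset.univ j') ^ N * a j ∈ Z.loc j' ∧
      (twist Finset.univ j / twist Finset.univ j') ^ N * t j ∈ regular j' := by
  choose N₁ h₁ using fun j j' : Chart n => exists_pow_mul_mem_loc (loc_le_left (j' := j') (ha j))
  choose N₂ h₂ using fun j j' : Chart n =>
    exists_pow_mul_mem_regular (regular_le_left j j' (ht j))
  refine ⟨∑ p : Chart n × Chart n, (N₁ p.1 p.2 + N₂ p.1 p.2), fun j j' => ?_⟩
  have hle : N₁ j j' + N₂ j j' ≤ ∑ p : Chart n × Chart n, (N₁ p.1 p.2 + N₂ p.1 p.2) :=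
    Finset.single_le_sum (f := fun p : Chart n × Chart n => N₁ p.1 p.2 + N₂ p.1 p.2)
      (fun _ _ => Nat.zero_le _) (Finset.mem_univ (j, j'))
  have hd := twist_div_mem_regular Finset.univ j j'
  obtain ⟨m₁, hm₁⟩ := Nat.exists_eq_add_of_le ((Nat.le_add_right _ _).trans hle)
  obtain ⟨m₂, hm₂⟩ := Nat.exists_eq_add_of_le ((Nat.le_add_left _ _).trans hle)
  constructor
  · rw [hm₁, add_comm, pow_add, mul_assoc]
    exact mul_mem_idealIn (pow_mem hd _) (h₁ j j')
  · rw [hm₂, add_comm, pow_add, mul_assoc]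
    exact mul_mem (pow_mem hd _) (h₂ j j')

/-- Let `Z` be zero-dimensional with `h¹(𝓘_Z(E)) = 0`, and `G` a section of `𝒪(F)`. Every section of
`𝒪(1)` vanishing on `Z ∩ {G = 0}` differs from a multiple of `G` by a section vanishing on `Z`.

On the charts this is the definition of `Z ∩ {G = 0}`. The local multipliers are patched to a
section of `𝒪(E)` over `Z` by a partition of unity `c_j x_j ^ N / g`, where `x_j` is the equation of
the complement of `U_j` and `g = ∑ c_j x_j ^ N` is invertible on `Z`; this section lifts to `Y`
since `h¹(𝓘_Z(E)) = 0`. -/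
lemma exists_sub_mul_mem_H0 (hZ : Z.IsZeroDimensional) (hdisj : Disjoint E F)
    (hcover : E ∪ F = Finset.univ) (h1 : Z.h1 E = 0) (hG : ∀ j, G / twist F j ∈ regular j)
    {s : RatField n} (hs : s ∈ (Z.inter hG).H0 Finset.univ) :
    ∃ t : RatField n, (∀ j, t / twist E j ∈ regular j) ∧ s - G * t ∈ Z.H0 Finset.univ := by
  have htw := twist_eq_mul (n := n) hdisj hcover
  have hE0 := twist_ne_zero (n := n) E
  have hF0 := twist_ne_zero (n := n) F
  have h0 := twist_ne_zero (n := n) Finset.univ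
  have hsreg : ∀ j, s / twist Finset.univ j ∈ regular j := fun j =>
    mem_of_mem_idealIn (mem_H0.mp hs j)
  choose a ha t ht hat using fun j => exists_of_mem_idealIn_sup_span (mem_H0.mp hs j)
  obtain ⟨N, hN⟩ := exists_uniform_pow ha ht
  obtain ⟨c, v, hv⟩ := exists_generic_unit hZ Finset.univ N
  set d : Chart n → Chart n → RatField n :=
    fun j j' => twist Finset.univ j / twist Finset.univ j' with hd
  set γ : Chart n → RatField n := fun j' => ∑ j, c j • d j j' ^ N with hγ
  -- the local expressions of the sections `∑ c_j x_j ^ N t_j` and `∑ c_j x_j ^ N a_j`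
  let τ : Chart n → RatField n :=
    fun j' => ∑ j, c j • (twist E j / twist E j' * (d j j' ^ N * t j))
  let α : Chart n → RatField n := fun j' => ∑ j, c j • (d j j' * (d j j' ^ N * a j))
  have hτ : ∀ j', τ j' ∈ regular j' := fun j' =>
    sum_mem fun j _ => Subalgebra.smul_mem _
      (mul_mem (twist_div_mem_regular E j j') (hN j j').2) _
  have hα : ∀ j', α j' ∈ Z.loc j' := fun j' =>
    sum_mem fun j _ => smul_mem_idealIn _
      (mul_mem_idealIn (twist_div_mem_regular Finset.univ j j') (hN j j').1)
  have hγs : ∀ j', γ j' * (s / twist Finset.univ j') = α j' + G / twist F j' * τ j' := fun j' => by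
    simp only [hγ, α, τ, Finset.sum_mul, Finset.mul_sum, ← Finset.sum_add_distrib]
    refine Finset.sum_congr rfl fun j _ => ?_
    have e : s / twist Finset.univ j' = d j j' * (a j + G / twist F j * t j) := by
      rw [← hat j, hd, mul_comm, div_mul_div_cancel₀ (h0 j)]
    have e' : d j j' * (G / twist F j) = G / twist F j' * (twist E j / twist E j') := by
      have := hE0 j'; have := hF0 j'; have := hF0 j
      simp only [hd, htw]
      field_simp
    rw [e, smul_mul_assoc, mul_smul_comm, ← smul_add]
    congr 1
    linear_combination (d j j' ^ N * t j) * e'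
  have hτγ : ∀ j j', τ j' * (twist E j' / twist E j) = τ j * d j j' ^ N := fun j j' => by
    simp only [τ, Finset.sum_mul]
    refine Finset.sum_congr rfl fun i _ => ?_
    rw [smul_mul_assoc, smul_mul_assoc]
    congr 1
    have e : d i j' = d i j * d j j' := (div_mul_div_cancel₀ (h0 j)).symm
    have e' : twist E i / twist E j = twist E i / twist E j' * (twist E j' / twist E j) :=
      (div_mul_div_cancel₀ (hE0 j')).symm
    rw [e, e', mul_pow]
    ring
  have hcoc : (fun j j' => v j' * τ j' * twist E j' - v j * τ j * twist E j) ∈ Z.cocycles E := by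
    refine ⟨fun j j' => ?_, fun j j' j'' => by ring⟩
    rw [mem_sections₂]
    have e : (v j' * τ j' * twist E j' - v j * τ j * twist E j) / twist E j =
        τ j * (v j' * d j j' ^ N - v j) := by
      rw [sub_div, mul_div_cancel_right₀ _ (hE0 j), mul_div_assoc, mul_assoc, hτγ]
      ring
    rw [e]
    refine mul_mem_idealIn (regular_le_left j j' (hτ j)) ?_
    exact inverse_transition (regular_le_left j j' (hv j).1) (regular_le_right j j' (hv j').1)
      (loc_le_left (hv j).2) (loc_le_right (hv j').2)
      (regular_le_right j j' (pow_mem (twist_div_mem_regular Finset.univ j j') N))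
      (sum_pow_twist_div Finset.univ N c j j')
  obtain ⟨r, hr, hrφ⟩ := mem_coboundaries_of_h1_eq_zero h1 hcoc
  -- the difference of the local sections and the cochain `r` does not depend on the chart
  let j₀ : Chart n := fun _ => 0
  have ht' : ∀ j, v j₀ * τ j₀ * twist E j₀ - r j₀ = v j * τ j * twist E j - r j := fun j => by
    linear_combination -hrφ j₀ j
  refine ⟨v j₀ * τ j₀ * twist E j₀ - r j₀, fun j => ?_, mem_H0.mpr fun j => ?_⟩
  · rw [ht' j, sub_div, mul_div_cancel_right₀ _ (hE0 j)]
    exact sub_mem (mul_mem (hv j).1 (hτ j)) (mem_of_mem_idealIn (mem_sections.mp (hr j)))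
  · have e : (s - G * (v j₀ * τ j₀ * twist E j₀ - r j₀)) / twist Finset.univ j =
        G / twist F j * (r j / twist E j) + v j * α j -
          s / twist Finset.univ j * (v j * γ j - 1) := by
      have e₁ : s / twist Finset.univ j * (v j * γ j - 1) =
          v j * (α j + G / twist F j * τ j) - s / twist Finset.univ j := by
        rw [← hγs]; ring
      rw [e₁, ht' j, htw j]
      have := hE0 j; have := hF0 j
      field_simp
      ring
    rw [e]
    exact sub_mem (add_mem (mul_mem_idealIn (hG j) (mem_sections.mp (hr j)))
      (mul_mem_idealIn (hv j).1 (hα j))) (mul_mem_idealIn (hsreg j) (hv j).2)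

/-- If the span of `Z` contains `T`, but that of no smaller scheme does, and `G` is a section of
`𝒪(F)` that does not vanish on `Z`, then some multiple of `G` does not vanish at `T`. -/
lemma exists_segrePullback_eq_mul (hZ : Z.IsZeroDimensional) (hdisj : Disjoint E F)
    (hcover : E ∪ F = Finset.univ) (h1 : Z.h1 E = 0) (T : ℙ ℂ (TensorSpace n))
    (hT : Z.SpanContains T)
    (hTmin : ∀ Z' : ClosedSubscheme n, Z'.IsProperSubscheme Z → ¬ Z'.SpanContains T)
    (hG : ∀ j, G / twist F j ∈ regular j) (hGZ : G ∉ Z.H0 F) :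
    ∃ (t : RatField n) (ℓ : Module.Dual ℂ (TensorSpace n)), (∀ j, t / twist E j ∈ regular j) ∧
      segrePullback ℓ = G * t ∧ ∃ x ∈ T.submodule, ℓ x ≠ 0 := by
  have h := hTmin _ (inter_isProperSubscheme hG hGZ)
  obtain ⟨x, hxT, hx⟩ := SetLike.not_le_iff_exists.mp h
  rw [linearSpan, Submodule.mem_dualCoannihilator] at hx
  push Not at hx
  obtain ⟨ℓ, hℓ, hℓx⟩ := hx
  obtain ⟨t, ht, hst⟩ := exists_sub_mul_mem_H0 hZ hdisj hcover h1 hG hℓ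
  have hGt : ∀ j, G * t / twist Finset.univ j ∈ regular j := fun j => by
    have e : G * t / twist Finset.univ j = G / twist F j * (t / twist E j) := by
      rw [twist_eq_mul hdisj hcover, div_mul_div_comm, mul_comm (twist F j)]
    rw [e]
    exact mul_mem (hG j) (ht j)
  obtain ⟨ℓ', hℓ'⟩ := exists_segrePullback_eq (mem_span_twist hGt)
  refine ⟨t, ℓ', ht, hℓ', x, hxT, ?_⟩
  have h2 := hT hxT
  rw [linearSpan, Submodule.mem_dualCoannihilator] at h2
  have h3 : (ℓ - ℓ') x = 0 := h2 _ (by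
    rw [Submodule.mem_comap, map_sub, hℓ']
    exact hst)
  rw [LinearMap.sub_apply, sub_eq_zero] at h3
  rwa [← h3]

end ClosedSubscheme

/-! ### Multilinear forms vanishing on a scheme of small degree -/

lemma finite_submodule_pi_quotient {ι : Type*} [Finite ι] {R : ι → Type*} [∀ j, CommRing (R j)]
    [∀ j, Algebra ℂ (R j)] (I : ∀ j, Ideal (R j)) (hI : ∀ j, Module.Finite ℂ (R j ⧸ I j))
    (p : Submodule ℂ (∀ j, R j ⧸ I j)) : Module.Finite ℂ p :=
  inferInstance

lemma sum_smul_twist_div_mem_regular {ι : Type*} [Fintype ι] (u : Finset (Fin k)) (w : ι → ℂ)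
    (φ : ι → Chart n) (j : Chart n) : (∑ a, w a • twist u (φ a)) / twist u j ∈ regular j := by
  rw [Finset.sum_div]
  refine sum_mem fun a _ => ?_
  rw [div_eq_mul_inv, smul_mul_assoc, ← div_eq_mul_inv]
  exact Subalgebra.smul_mem _ (twist_div_mem_regular u _ j) _

namespace ClosedSubscheme

variable {Z : ClosedSubscheme n} {u : Finset (Fin k)}

/-- If `h⁰(𝓘_Z(u))` is less than `∏_{i ∈ u} (n i + 1) - c`, then any `c` linear conditions on
multilinear forms in the variables of `u` are satisfied by a form that does not vanish on `Z`. -/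
lemma exists_form_notMem_H0 {V : Type*} [AddCommMonoid V] [Module ℂ V] [Module.Finite ℂ V] {c : ℕ}
    (hV : Module.finrank ℂ V ≤ c)
    (hc : Z.h0 u < (((∏ i ∈ u, (n i + 1)) - c : ℕ) : Cardinal))
    (Ψ : ((∀ i : u, Fin (n i + 1)) → ℂ) →ₗ[ℂ] V) :
    ∃ w, Ψ w = 0 ∧ ∑ a, w a • twist u (extendChart u a) ∉ Z.H0 u := by
  let _ : AddCommGroup V := Module.addCommMonoidToAddCommGroup ℂ
  by_contra! h
  let L : ((∀ i : u, Fin (n i + 1)) → ℂ) →ₗ[ℂ] RatField n :=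
    Fintype.linearCombination ℂ fun a => twist u (extendChart u a)
  have hL : Function.Injective L :=
    linearIndependent_iff_injective_fintypeLinearCombination.mp
      (linearIndependent_twist_extendChart u)
  let L' : LinearMap.ker Ψ →ₗ[ℂ] Z.H0 u := L.restrict fun w hw => h w hw
  have hL' : Function.Injective L' := fun w w' hww =>
    Subtype.ext (hL (congrArg Subtype.val hww))
  have h1 := LinearMap.rank_le_of_injective L' hL'
  rw [← Module.finrank_eq_rank] at h1
  have h2 : Module.finrank ℂ (LinearMap.ker Ψ) < (∏ i ∈ u, (n i + 1)) - c := by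
    exact_mod_cast h1.trans_lt hc
  have h3 := LinearMap.finrank_range_add_finrank_ker Ψ
  have h4 : Module.finrank ℂ ((∀ i : u, Fin (n i + 1)) → ℂ) = ∏ i ∈ u, (n i + 1) := by
    rw [Module.finrank_fintype_fun_eq_card, Fintype.card_pi]
    simp only [Fintype.card_fin]
    exact Finset.prod_coe_sort u fun i => n i + 1
  have h5 := Submodule.finrank_le (LinearMap.range Ψ)
  omega

lemma mk_mem_globalFunctions {f : ∀ j, regular j}
    (hf : ∀ j j', (f j' : RatField n) - f j ∈ Z.loc₂ j j') :
    (fun j => Ideal.Quotient.mkₐ ℂ (Z.ideal j) (f j)) ∈ Z.globalFunctions := by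
  simp only [globalFunctions, Submodule.mem_iInf, LinearMap.mem_eqLocus]
  intro j j'
  change Ideal.Quotient.mk (Z.ideal₂ j j') (resL j j' (f j)) =
    Ideal.Quotient.mk (Z.ideal₂ j j') (resR j j' (f j'))
  rw [eq_comm, Ideal.Quotient.eq, ← coe_mem_idealIn]
  exact hf j j'

lemma finite_globalFunctions (hZ : Z.IsZeroDimensional) : Module.Finite ℂ Z.globalFunctions :=
  finite_submodule_pi_quotient Z.ideal (finite_quotient hZ) Z.globalFunctions

/-- Vanishing on a zero-dimensional scheme `Z` imposes at most `deg Z` linear conditions on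
multilinear forms: division by a nowhere vanishing form turns their restrictions to `Z` into
functions on `Z`. -/
lemma exists_linearMap_globalFunctions (hZ : Z.IsZeroDimensional) (u : Finset (Fin k)) :
    ∃ Ψ : ((∀ i : u, Fin (n i + 1)) → ℂ) →ₗ[ℂ] Z.globalFunctions,
      ∀ w, Ψ w = 0 → ∑ a, w a • twist u (extendChart u a) ∈ Z.H0 u := by
  obtain ⟨c, v, hv⟩ := exists_generic_unit hZ u 1
  let y : ∀ j, (∀ i : u, Fin (n i + 1)) → regular j := fun j a =>
    ⟨twist u (extendChart u a) / twist u j * v j, mul_mem (twist_div_mem_regular u _ j) (hv j).1⟩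
  let φ : ∀ j, ((∀ i : u, Fin (n i + 1)) → ℂ) →ₗ[ℂ] regular j :=
    fun j => Fintype.linearCombination ℂ (y j)
  have hφ : ∀ j w, (φ j w : RatField n) =
      (∑ a, w a • twist u (extendChart u a)) / twist u j * v j := fun j w => by
    have e : (φ j w : RatField n) = ∑ a, w a • (twist u (extendChart u a) / twist u j * v j) := by
      rw [Fintype.linearCombination_apply, AddSubmonoidClass.coe_finsetSum]
      rfl
    rw [e, Finset.sum_div, Finset.sum_mul]
    refine Finset.sum_congr rfl fun a _ => ?_
    rw [div_eq_mul_inv, div_eq_mul_inv, smul_mul_assoc, smul_mul_assoc]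
  have hreg := fun w => sum_smul_twist_div_mem_regular u w (extendChart (n := n) u)
  refine ⟨LinearMap.codRestrict _ (LinearMap.pi fun j =>
    (Ideal.Quotient.mkₐ ℂ (Z.ideal j)).toLinearMap ∘ₗ φ j) fun w =>
      mk_mem_globalFunctions fun j j' => ?_, fun w hw => mem_H0.mpr fun j => ?_⟩
  · rw [hφ, hφ]
    have e : ∀ f : RatField n, f / twist u j' * v j' - f / twist u j * v j =
        f / twist u j * (v j' * (twist u j / twist u j') ^ 1 - v j) := fun f => by
      have := twist_ne_zero u j; have := twist_ne_zero u j'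
      field_simp
    rw [e]
    exact mul_mem_idealIn (regular_le_left j j' (hreg w j))
      (inverse_transition (regular_le_left j j' (hv j).1) (regular_le_right j j' (hv j').1)
        (loc_le_left (hv j).2) (loc_le_right (hv j').2)
        (regular_le_right j j' (pow_mem (twist_div_mem_regular u j j') 1))
        (sum_pow_twist_div u 1 c j j'))
  · have h1 : Ideal.Quotient.mk (Z.ideal j) (φ j w) = 0 := congrFun (congrArg Subtype.val hw) j
    rw [Ideal.Quotient.eq_zero_iff_mem, ← coe_mem_idealIn, hφ] at h1
    set f := (∑ a, w a • twist u (extendChart u a)) / twist u j with hf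
    set γ := ∑ i, c i • (twist u i / twist u j) ^ 1 with hγ
    have e : f = γ * (f * v j) - f * (v j * γ - 1) := by ring
    rw [e]
    refine sub_mem (mul_mem_idealIn ?_ h1) (mul_mem_idealIn (hreg w j) (hv j).2)
    exact sum_mem fun i _ =>
      Subalgebra.smul_mem _ (pow_mem (twist_div_mem_regular u i j) 1) _

end ClosedSubscheme

end MultiProj

open MultiProj ClosedSubscheme in
theorem theorem3p1 {k : ℕ} (n : Fin k → ℕ) (E F : Finset (Fin k))
    (hE : E.Nonempty) (hF : F.Nonempty) (hdisj : Disjoint E F) (hcover : E ∪ F = Finset.univ)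
    (c : ℕ) (hc : 0 < c) (hcF : c < ∏ i ∈ F, (n i + 1))
    (A : MultiProj.ClosedSubscheme n) (hA : A.IsZeroDimensional)
    (hA1 : A.h1 E = 0) (hA0 : A.h0 F < (((∏ i ∈ F, (n i + 1)) - c : ℕ) : Cardinal))
    (T : ℙ ℂ (MultiProj.TensorSpace n)) (hT : A.SpanContains T)
    (hTmin : ∀ A' : MultiProj.ClosedSubscheme n, A'.IsProperSubscheme A → ¬ A'.SpanContains T) :
    (∀ B : MultiProj.ClosedSubscheme n, B.IsZeroDimensional → B.degree ≤ c →
      ¬ B.SpanContains T) ∧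
    ((c + 1 : ℕ) : ℕ∞) ≤ MultiProj.cactusRank T ∧
    ((c + 1 : ℕ) : ℕ∞) ≤ MultiProj.tensorRank T := by
  have hB : ∀ B : MultiProj.ClosedSubscheme n, B.IsZeroDimensional → B.degree ≤ c →
      ¬ B.SpanContains T := by
    intro B hB hdeg hBT
    obtain ⟨Ψ, hΨ⟩ := exists_linearMap_globalFunctions hB F
    have := finite_globalFunctions hB
    obtain ⟨w, hw, hwA⟩ := exists_form_notMem_H0 (V := B.globalFunctions) hdeg hA0 Ψ
    obtain ⟨t, ℓ, ht, hℓ, x, hx, hℓx⟩ :=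
      exists_segrePullback_eq_mul hA hdisj hcover hA1 T hT hTmin
        (sum_smul_twist_div_mem_regular F w _) hwA
    have h1 := hBT hx
    rw [linearSpan, Submodule.mem_dualCoannihilator] at h1
    refine hℓx (h1 ℓ ?_)
    rw [Submodule.mem_comap, hℓ, mem_H0]
    intro j
    rw [twist_eq_mul hdisj hcover, mul_comm (twist E j), ← div_mul_div_comm, mul_comm]
    exact mul_mem_idealIn (ht j) (mem_H0.mp (hΨ w hw) j)
  refine ⟨hB, le_iInf₂ fun Z hZ => ?_, le_iInf₂ fun S hS => ?_⟩
  · by_contra! h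
    exact hB Z hZ.1 (Nat.lt_succ_iff.mp (by exact_mod_cast h)) hZ.2
  · by_contra! h
    have hcard : S.card ≤ c := Nat.lt_succ_iff.mp (by exact_mod_cast h)
    -- the conditions on a multilinear form to vanish at the points of `S`
    let Ψ : ((∀ i : F, Fin (n i + 1)) → ℂ) →ₗ[ℂ] (S → ℂ) := LinearMap.pi fun p =>
      Fintype.linearCombination ℂ fun a => ∏ i ∈ F, (p.1 i).rep (extendChart F a i)
    obtain ⟨w, hw, hwA⟩ := exists_form_notMem_H0 (by simpa using hcard) hA0 Ψ
    obtain ⟨t, ℓ, ht, hℓ, x, hx, hℓx⟩ :=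
      exists_segrePullback_eq_mul hA hdisj hcover hA1 T hT hTmin
        (sum_smul_twist_div_mem_regular F w _) hwA
    refine hℓx (?_ : x ∈ LinearMap.ker ℓ)
    refine Submodule.span_le.mpr ?_ (hS hx)
    rintro _ ⟨p, hp, rfl⟩
    exact dual_tprod_eq_zero w (extendChart F) (mem_span_twist ht) hℓ _
      (congrFun hw ⟨p, hp⟩)
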